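/- A submodular MDP consists of a finite state space $\mathcal S$, a finite nonempty action space $\mathcal A$, a horizon $H\ge 1$, a transition operator $P:\mathcal S\times\mathcal A\to\Delta(\mathcal S)$, disjoint levels $\mathcal S_1,\dots,\mathcal S_H\subseteq\mathcal S$ with a fixed initial state $s_1\in\mathcal S_1$, such that $P(s,a)$ is supported on $\mathcal S_{h+1}$ for $s\in\mathcal S_h$, $h<H$, and a monotone submodular function $f:2^{\mathcal S\times\mathcal A}\to\mathbb R_{\ge 0}$. A policy $\pi:\mathcal S^*\to\Delta(\mathcal A)$ induces a random trajectory by $a_h\sim\pi(s_1,\dots,s_h)$, $s_{h+1}\sim P(s_h,a_h)$; write $f(\pi)=\mathbb E\,f(\{(s_1,a_1),\dots,(s_H,a_H)\})$, and $x(\pi)_e$ for the probability that $e\in\mathcal S\times\mathcal A$ lies on the trajectory. For a policy that is itself drawn at random (once, before the episode), $f$ is also averaged over that draw. For $y\in[0,1]^{\mathcal S\times\mathcal A}$ let $S^y\subseteq\mathcal S\times\mathcal A$ be the random set that contains each $e$ independently with probability $y_e$. The discretized continuous greedy algorithm sets $\delta=\frac1{9|\mathcal S|^2|\mathcal A|^2}$,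 $T=1/\delta$, $R=\lceil 10(1+\log(|\mathcal S||\mathcal A|))/\delta^2\rceil$ and $y_0=0$. For $t=1,\dots,T$ it computes, for each $e\in\mathcal S\times\mathcal A$, the average $w_t(e)$ of $f(X\cup\{e\})-f(X\setminus\{e\})$ over $R$ fresh independent samples $X$ of $S^{y_{t-1}}$; it finds by dynamic programming (backward induction for the MDP with additive reward $w_t$, ties broken arbitrarily) a deterministic policy $\pi_t$ maximizing $x(\pi_t)\cdot w_t$; and it sets $y_t=y_{t-1}+\delta\,x(\pi_t)$. Its output is the random policy $\pi$ that is uniformly distributed over $\pi_1,\dots,\pi_T$. Theorem. There is a function $\varepsilon:\mathbb N\to[0,1-1/e]$ with $\varepsilon(n)\to0$ as $n\to\infty$ such that, for every submodular MDP and every tie-breaking rule, with probability at least $0.99$ over the samples of the algorithm, $$f(\pi)\ \ge\ \frac{\bigl(1-1/e-\varepsilon(|\mathcal S||\mathcal A|)\bigr)^2}{H}\, f(\pi^*)\qquad\text{for every policy }\pi^*,$$ in particular for an optimal policy $\pi^*$. -/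

import Mathlib

open scoped ENNReal

/-- A finite-horizon tabular Markov decision process with a monotone submodular objective.
Levels are numbered `0, …, H - 1`; the states at level `h` are `{s | level s = h}`, so that
different levels are disjoint.  States with `level s ≥ H` belong to no level of the process. -/
structure SubmodularMDP (S A : Type*) [DecidableEq S] [DecidableEq A] where
  /-- the planning horizon -/
  H : ℕ
  H_pos : 0 < H
  /-- the transition operator -/
  P : S → A → PMF S
  /-- the fixed initial state -/
  s₁ : S
  level : S → ℕ
  level_init : level s₁ = 0
  level_step : ∀ s a s', level s + 1 < H → s' ∈ (P s a).support → level s' = level s + 1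
  /-- the objective function -/
  f : Finset (S × A) → ℝ
  f_nonneg : ∀ X, 0 ≤ f X
  f_mono : ∀ X Y, X ⊆ Y → f X ≤ f Y
  f_submodular : ∀ X Y, f (X ∪ Y) + f (X ∩ Y) ≤ f X + f Y

/-- A policy prescribes a distribution over actions for each sequence of states
`[s₁, …, s_h]` (the states visited so far, in chronological order, ending in the current one). -/
abbrev Policy (S A : Type*) := List S → PMF A

noncomputable section

/-- The product distribution: independent coordinates, the `i`-th one with law `p i`. -/
def indepPMF {ι α : Type*} [Fintype ι] [DecidableEq ι] [Fintype α] (p : ι → PMF α) :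
    PMF (ι → α) :=
  PMF.ofFintype (fun g => ∏ i, p i (g i)) (by
    have h : ∀ i, ∑ a, p i a = 1 := fun i => by
      rw [← tsum_fintype (L := .unconditional _)]
      exact (p i).tsum_coe
    rw [← Fintype.prod_sum]
    simp [h])

/-- A coin that shows `true` with probability `x` (for real `x` in `[0, 1]`; other values are
replaced by the nearest point of `[0, 1]`). -/
def coin (x : ℝ) : PMF Bool :=
  PMF.ofFintype (fun b => bif b then min 1 (ENNReal.ofReal x) else 1 - min 1 (ENNReal.ofReal x))
    (by simp)

/-- The law of the random subset `S^x`, which contains each `e` independently with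
probability `x e`. -/
def randomSubset {E : Type*} [Fintype E] [DecidableEq E] (x : E → ℝ) : PMF (Finset E) :=
  (indepPMF fun e => coin (x e)).map fun b => Finset.univ.filter fun e => b e = true

namespace SubmodularMDP

variable {S A : Type*} [DecidableEq S] [DecidableEq A]

/-- The law of the next `k` state-action pairs under the policy `π`, when the current state is
`s` and the earlier states were `hist`. -/
def rollout (M : SubmodularMDP S A) (π : Policy S A) : ℕ → List S → S → PMF (List (S × A))
  | 0, _, _ => PMF.pure []
  | k + 1, hist, s =>
      (π (hist ++ [s])).bind fun a =>
        (M.P s a).bind fun s' =>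
          (M.rollout π k (hist ++ [s]) s').map fun tr => (s, a) :: tr

/-- The law of the trajectory `(s₁, a₁), …, (s_H, a_H)` induced by `π`. -/
def trajectory (M : SubmodularMDP S A) (π : Policy S A) : PMF (List (S × A)) :=
  M.rollout π M.H [] M.s₁

/-- The law of the set of state-action pairs on the trajectory induced by `π`. -/
def visited (M : SubmodularMDP S A) (π : Policy S A) : PMF (Finset (S × A)) :=
  (M.trajectory π).map List.toFinset

variable [Fintype S] [Fintype A]

/-- The expectation `𝔼 f(X)` for a random set `X` with law `μ`. -/
def expect (M : SubmodularMDP S A) (μ : PMF (Finset (S × A))) : ℝ :=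
  ∑ X, (μ X).toReal * M.f X

/-- The expected objective value `f(π)` of a policy. -/
def value (M : SubmodularMDP S A) (π : Policy S A) : ℝ :=
  M.expect (M.visited π)

/-- The expected objective value of a random policy: first a policy is drawn from `ρ`, then it is
followed for the whole episode. -/
def randomValue (M : SubmodularMDP S A) (ρ : PMF (Policy S A)) : ℝ :=
  M.expect (ρ.bind M.visited)

/-- The marginal probability `x(π)_e` that `e` lies on the trajectory induced by `π`. -/
def marginal (M : SubmodularMDP S A) (π : Policy S A) (e : S × A) : ℝ :=
  ∑ X with e ∈ X, (M.visited π X).toReal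

/-- A deterministic Markov policy `d : S → A`, viewed as a policy: it plays `d s` in the current
state `s`, i.e. the last one of the sequence. -/
def ofDet (M : SubmodularMDP S A) (d : S → A) : Policy S A :=
  fun hist => PMF.pure (d (hist.getLastD M.s₁))

section DynamicProgramming

variable [Nonempty A]

/-- The optimal value-to-go from state `s` with `k` steps left, for the additive reward `w`. -/
def dpValue (M : SubmodularMDP S A) (w : S × A → ℝ) : ℕ → S → ℝ
  | 0, _ => 0
  | k + 1, s => Finset.univ.sup' Finset.univ_nonempty fun a =>
      w (s, a) + ∑ s', (M.P s a s').toReal * M.dpValue w k s'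

/-- The optimal state-action value when `k` further steps follow the present one. -/
def dpQ (M : SubmodularMDP S A) (w : S × A → ℝ) (k : ℕ) (s : S) (a : A) : ℝ :=
  w (s, a) + ∑ s', (M.P s a s').toReal * M.dpValue w k s'

/-- The deterministic policy that dynamic programming returns for the additive reward `w`; among
the maximizing actions at `s` it takes the one that the tie-breaking rule `arg s` selects. -/
def dpPolicy (M : SubmodularMDP S A) (arg : S → (A → ℝ) → A) (w : S × A → ℝ) : S → A :=
  fun s => arg s (M.dpQ w (M.H - 1 - M.level s) s)

end DynamicProgramming

end SubmodularMDP

/-- `arg t s q` is a maximizer of `q`, for each iteration `t` and each state `s`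
(ties may be broken in any way). -/
def IsArgmaxRule {S A : Type*} (arg : ℕ → S → (A → ℝ) → A) : Prop :=
  ∀ (t : ℕ) (s : S) (q : A → ℝ) (a : A), q a ≤ q (arg t s q)

section Parameters

variable (S A : Type*) [Fintype S] [Fintype A]

/-- The step size `δ = 1 / (9 |S|² |A|²)`. -/
def stepSize : ℝ := 1 / (9 * (Fintype.card S : ℝ) ^ 2 * (Fintype.card A : ℝ) ^ 2)

/-- The number of iterations `T = 1 / δ`. -/
def numSteps : ℕ := 9 * Fintype.card S ^ 2 * Fintype.card A ^ 2

/-- The number of samples per estimate, `R = 10 (1 + log (|S| |A|)) / δ²`, rounded up. -/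
def numSamples : ℕ :=
  ⌈10 * (1 + Real.log ((Fintype.card S : ℝ) * (Fintype.card A : ℝ))) / stepSize S A ^ 2⌉₊

end Parameters

namespace SubmodularMDP

variable {S A : Type*} [DecidableEq S] [DecidableEq A] [Fintype S] [Fintype A]

/-- The law of the vector `w` of estimates at `y`: for each `e`, the average of
`f(X ∪ {e}) - f(X \ {e})` over `R` independent samples `X` of the random set `S^y`. -/
def gradientEstimate (M : SubmodularMDP S A) (y : S × A → ℝ) : PMF (S × A → ℝ) :=
  (indepPMF fun _ : (S × A) × Fin (numSamples S A) => randomSubset y).map fun X e =>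
    (∑ r, (M.f (insert e (X (e, r))) - M.f ((X (e, r)).erase e))) / (numSamples S A : ℝ)

/-- The point `y_k = δ (x(π₁) + ⋯ + x(π_k))` reached after `k` iterations. -/
def position (M : SubmodularMDP S A) {k : ℕ} (d : Fin k → S → A) (e : S × A) : ℝ :=
  ∑ i, stepSize S A * M.marginal (M.ofDet (d i)) e

variable [Nonempty A]

/-- The law of the policies `π₁, …, π_k` found in the first `k` iterations. -/
def iterates (M : SubmodularMDP S A) (arg : ℕ → S → (A → ℝ) → A) :
    (k : ℕ) → PMF (Fin k → S → A)
  | 0 => PMF.pure Fin.elim0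
  | k + 1 => (M.iterates arg k).bind fun d =>
      (M.gradientEstimate (M.position d)).map fun w =>
        Fin.snoc (α := fun _ => S → A) d (M.dpPolicy (arg k) w)

/-- The random policy that is uniformly distributed over `π₁, …, π_T`. -/
def mixture (M : SubmodularMDP S A) (d : Fin (numSteps S A) → S → A) : PMF (Policy S A) :=
  haveI : Nonempty S := ⟨M.s₁⟩
  haveI : Nonempty (Fin (numSteps S A)) :=
    ⟨⟨0, Nat.mul_pos (Nat.mul_pos (by norm_num) (pow_pos Fintype.card_pos 2))
      (pow_pos Fintype.card_pos 2)⟩⟩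
  (PMF.uniformOfFintype (Fin (numSteps S A))).map fun t => M.ofDet (d t)

/-- The discretized continuous greedy algorithm: the law of its output, a random policy. -/
def continuousGreedy (M : SubmodularMDP S A) (arg : ℕ → S → (A → ℝ) → A) :
    PMF (PMF (Policy S A)) :=
  (M.iterates arg (numSteps S A)).map M.mixture

end SubmodularMDP

end

/-! Let F be the multilinear extension of `f`, n = |S||A|, r_e = f{e} - f∅, opt the supremum of all
policy values, and g_t the gradient of F at y_t. Averaging submodularity gives opt ≤ F(y) + max_π
x(π)·∇F(y) at every y in the cube (`value_le_multilinear_add`), and backward induction attains the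
maximum of an additive reward (`additiveValue_dpPolicy`). So the gap opt - F(y_t) contracts by 1 - δ
per step, up to two errors.

Discretization: by concavity along nonnegative directions, a step gains at least δ x(π_t)·g_t, with
the gradient taken at its end, so the loss is δ x(π_t)·(g_{t-1} - g_t). Gradients decrease along the
run; replacing x(π_t) by a bound m valid for all policies makes these losses telescope to δ m·(g_0 -
g_T) (`sub_multilinear_position_le`). Sampling: the loss of a step is at most δ Σ m_e |w_e - g_e|,
whose mean is at most δ² Σ m_e r_e (`mean_regret_le`); Markov's inequality on the total loss takes
the place of a union bound.

Visiting e with probability p already yields value at least p r_e, so m can be chosen with m_e r_e ≤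
opt (`exists_marginal_bound`). Both errors are then O(opt/n), and F(y_T) ≥ (1 - 1/e - 12/n) opt with
probability 0.99.

The factor H comes from passing back to policies: F lies below its linearization at 0, while a
trajectory of at most H pairs is worth at least the average of its singletons
(`multilinear_position_le_horizon_mul_randomValue`). This gives the first power of 1 - 1/e - ε; the
square is weaker. -/

namespace PMF

/-! ### Expectations under finite distributions. -/

variable {α β : Type*} [Fintype α] [Fintype β]

/-- The expectation of a real function under a distribution on a finite type. -/
noncomputable def mean (p : PMF α) (g : α → ℝ) : ℝ := ∑ a, (p a).toReal * g a

theorem sum_toReal (p : PMF α) : ∑ a, (p a).toReal = 1 := by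
  rw [← ENNReal.toReal_sum fun a _ => p.apply_ne_top a,
    ← tsum_fintype (L := .unconditional _), p.tsum_coe, ENNReal.toReal_one]

theorem mean_const (p : PMF α) (c : ℝ) : p.mean (fun _ => c) = c := by
  rw [mean, ← Finset.sum_mul, sum_toReal, one_mul]

theorem mean_add (p : PMF α) (g h : α → ℝ) :
    p.mean (fun a => g a + h a) = p.mean g + p.mean h := by
  simp only [mean, mul_add, Finset.sum_add_distrib]

theorem mean_const_add (p : PMF α) (c : ℝ) (g : α → ℝ) :
    p.mean (fun a => c + g a) = c + p.mean g := by
  rw [mean_add, mean_const]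

theorem mean_sub (p : PMF α) (g h : α → ℝ) :
    p.mean (fun a => g a - h a) = p.mean g - p.mean h := by
  simp only [mean, mul_sub, Finset.sum_sub_distrib]

theorem mean_mul_left (p : PMF α) (c : ℝ) (g : α → ℝ) :
    p.mean (fun a => c * g a) = c * p.mean g := by
  simp only [mean, Finset.mul_sum]
  exact Finset.sum_congr rfl fun a _ => by ring

theorem mean_sum {ι : Type*} (s : Finset ι) (p : PMF α) (g : ι → α → ℝ) :
    p.mean (fun a => ∑ i ∈ s, g i a) = ∑ i ∈ s, p.mean (g i) := by
  simp only [mean, Finset.mul_sum]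
  exact Finset.sum_comm

theorem mean_le_mean_of_support {p : PMF α} {g h : α → ℝ} (H : ∀ a ∈ p.support, g a ≤ h a) :
    p.mean g ≤ p.mean h := by
  refine Finset.sum_le_sum fun a _ => ?_
  by_cases ha : a ∈ p.support
  · exact mul_le_mul_of_nonneg_left (H a ha) ENNReal.toReal_nonneg
  · rw [(p.apply_eq_zero_iff a).2 ha]; simp

theorem mean_congr_of_support {p : PMF α} {g h : α → ℝ} (H : ∀ a ∈ p.support, g a = h a) :
    p.mean g = p.mean h :=
  le_antisymm (mean_le_mean_of_support fun a ha => (H a ha).le)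
    (mean_le_mean_of_support fun a ha => (H a ha).ge)

theorem mean_mono {p : PMF α} {g h : α → ℝ} (H : ∀ a, g a ≤ h a) : p.mean g ≤ p.mean h :=
  mean_le_mean_of_support fun a _ => H a

theorem mean_nonneg {p : PMF α} {g : α → ℝ} (H : ∀ a, 0 ≤ g a) : 0 ≤ p.mean g :=
  Finset.sum_nonneg fun a _ => mul_nonneg ENNReal.toReal_nonneg (H a)

theorem mean_bind (p : PMF α) (q : α → PMF β) (g : β → ℝ) :
    (p.bind q).mean g = p.mean fun a => (q a).mean g := by
  have h : ∀ b, ((p.bind q) b).toReal = ∑ a, (p a).toReal * (q a b).toReal := fun b => by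
    rw [bind_apply, tsum_fintype,
      ENNReal.toReal_sum fun a _ => ENNReal.mul_ne_top (p.apply_ne_top a) ((q a).apply_ne_top b)]
    simp only [ENNReal.toReal_mul]
  simp only [mean, h, Finset.sum_mul, Finset.mul_sum]
  rw [Finset.sum_comm]
  exact Finset.sum_congr rfl fun a _ => Finset.sum_congr rfl fun b _ => by ring

theorem mean_pure (a : α) (g : α → ℝ) : (pure a).mean g = g a := by
  classical
  rw [mean, Finset.sum_eq_single a]
  · simp
  · intro b _ hb
    simp [pure_apply, hb]
  · simp

theorem mean_map (p : PMF α) (u : α → β) (g : β → ℝ) : (p.map u).mean g = p.mean (g ∘ u) := by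
  rw [← bind_pure_comp, mean_bind]
  simp only [Function.comp_apply, mean_pure]
  rfl

theorem sq_mean_le (p : PMF α) (g : α → ℝ) : p.mean g ^ 2 ≤ p.mean fun a => g a ^ 2 := by
  have h : 0 ≤ p.mean fun a => (g a - p.mean g) ^ 2 := mean_nonneg fun a => sq_nonneg _
  have h' : (fun a => (g a - p.mean g) ^ 2)
      = fun a => (g a ^ 2 - (2 * p.mean g) * g a) + p.mean g ^ 2 := by
    funext a; ring
  rw [h', mean_add, mean_sub, mean_mul_left, mean_const] at h
  nlinarith

/-- Markov's inequality, for the complementary event. -/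
theorem one_sub_le_toOuterMeasure_of_mean_le {p : PMF α} {g : α → ℝ} {b c : ℝ} (hg : ∀ a, 0 ≤ g a)
    (hc : 0 < c) (h : p.mean g ≤ b * c) :
    ENNReal.ofReal (1 - b) ≤ p.toOuterMeasure {a | g a ≤ c} := by
  classical
  rw [toOuterMeasure_apply_fintype]
  have hreal : 1 - b ≤ ∑ a, (if g a ≤ c then (p a).toReal else 0) := by
    have h1 : c * (1 - ∑ a, (if g a ≤ c then (p a).toReal else 0)) ≤ p.mean g := by
      rw [← p.sum_toReal, ← Finset.sum_sub_distrib, Finset.mul_sum]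
      refine Finset.sum_le_sum fun a _ => ?_
      have hp : 0 ≤ (p a).toReal := ENNReal.toReal_nonneg
      split_ifs with hac
      · simpa using mul_nonneg hp (hg a)
      · rw [sub_zero, mul_comm]
        exact mul_le_mul_of_nonneg_left (not_le.1 hac).le hp
    nlinarith
  refine (ENNReal.ofReal_le_ofReal hreal).trans (le_of_eq ?_)
  rw [ENNReal.ofReal_sum_of_nonneg fun a _ => by split_ifs <;> simp]
  refine Finset.sum_congr rfl fun a _ => ?_
  by_cases hac : g a ≤ c
  · simp [hac, ENNReal.ofReal_toReal (p.apply_ne_top a)]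
  · simp [hac]

end PMF

/-! ### Independent coordinates and empirical averages. -/

section Independence

variable {ι α : Type*} [Fintype ι] [DecidableEq ι] [Fintype α]

theorem mean_indepPMF_prod (p : ι → PMF α) (φ : ι → α → ℝ) :
    (indepPMF p).mean (fun X => ∏ i, φ i (X i)) = ∏ i, (p i).mean (φ i) := by
  simp only [PMF.mean]
  rw [Fintype.prod_sum]
  refine Finset.sum_congr rfl fun X _ => ?_
  rw [Finset.prod_mul_distrib, indepPMF, PMF.ofFintype_apply, ENNReal.toReal_prod]

/-- In the product formula the factor at `i` is the mean of `g`. This removes the cross terms of a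
variance. -/
theorem mean_indepPMF_mul_eq_zero (p : ι → PMF α) {i j : ι} (hij : i ≠ j) (g h : α → ℝ)
    (hg : (p i).mean g = 0) : (indepPMF p).mean (fun X => g (X i) * h (X j)) = 0 := by
  have key := mean_indepPMF_prod p fun k x => (if k = i then g x else 1) * (if k = j then h x else 1)
  simp only [Finset.prod_mul_distrib, Finset.prod_ite_eq', Finset.mem_univ, if_true] at key
  rw [key]
  exact Finset.prod_eq_zero (Finset.mem_univ i) (by simpa [hij] using hg)

/-- The variance of a sum of independent centred variables is at most the sum of the bounds on the
variances of the summands. -/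
theorem mean_indepPMF_sq_sum_le (p : ι → PMF α) (s : Finset ι) (g : ι → α → ℝ) (b : ℝ)
    (hg : ∀ i ∈ s, (p i).mean (g i) = 0) (hb : ∀ i ∈ s, ∀ x, g i x ^ 2 ≤ b) :
    (indepPMF p).mean (fun X => (∑ i ∈ s, g i (X i)) ^ 2) ≤ s.card * b := by
  simp only [sq (∑ i ∈ s, _), Finset.sum_mul_sum]
  rw [PMF.mean_sum, ← nsmul_eq_mul]
  refine Finset.sum_le_card_nsmul _ _ _ fun i hi => ?_
  rw [PMF.mean_sum, Finset.sum_eq_single_of_mem i hi fun j _ hj =>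
    mean_indepPMF_mul_eq_zero p hj.symm (g i) (g j) (hg i hi)]
  refine (PMF.mean_mono fun X => ?_).trans_eq (PMF.mean_const _ b)
  rw [← sq]
  exact hb i hi _

/-- The mean absolute deviation of an empirical average of independent samples. -/
theorem mean_abs_average_sub_le (p : ι → PMF α) {R : ℕ} (hR : 0 < R) (k : Fin R → ι)
    (hk : Function.Injective k) (g : α → ℝ) (μ r : ℝ) (hr : 0 ≤ r)
    (hg : ∀ i, (p (k i)).mean g = μ) (hb : ∀ x, |g x - μ| ≤ r) :
    (indepPMF p).mean (fun X => |(∑ i, g (X (k i))) / R - μ|) ≤ r / √R := by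
  classical
  have hR' : (0 : ℝ) < R := Nat.cast_pos.2 hR
  -- The first absolute moment is bounded by the second moment, that is, by the variance of the
  -- average.
  refine abs_le_of_sq_le_sq' (b := r / √R) ?_ (by positivity) |>.2
  refine (PMF.sq_mean_le _ _).trans ?_
  have h1 := mean_indepPMF_sq_sum_le p (Finset.univ.image k) (fun _ x => g x - μ) (r ^ 2)
    (by
      intro i hi
      obtain ⟨j, -, rfl⟩ := Finset.mem_image.1 hi
      rw [PMF.mean_sub, hg, PMF.mean_const, sub_self])
    (fun i _ x => sq_le_sq' (abs_le.1 (hb x)).1 (abs_le.1 (hb x)).2)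
  rw [Finset.card_image_of_injective _ hk, Finset.card_univ, Fintype.card_fin] at h1
  have h2 : (fun X : ι → α => |(∑ i, g (X (k i))) / (R : ℝ) - μ| ^ 2)
      = fun X => ((R : ℝ) ^ 2)⁻¹ * (∑ i ∈ Finset.univ.image k, (g (X i) - μ)) ^ 2 := by
    funext X
    rw [sq_abs, Finset.sum_image fun a _ b _ h => hk h, Finset.sum_sub_distrib, Finset.sum_const,
      Finset.card_univ, Fintype.card_fin, nsmul_eq_mul]
    field_simp
  rw [h2, PMF.mean_mul_left, div_pow, Real.sq_sqrt hR'.le]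
  refine (mul_le_mul_of_nonneg_left h1 (by positivity)).trans_eq ?_
  field_simp

end Independence

/-! ### The multilinear extension of a set function. -/

section Multilinear

variable {E : Type*} [Fintype E] [DecidableEq E]

/-- The probability that the random set with independent elements and marginals `y` equals `X`. -/
noncomputable def subsetWeight (y : E → ℝ) (X : Finset E) : ℝ :=
  ∏ i, if i ∈ X then y i else 1 - y i

/-- The multilinear extension of a set function. -/
noncomputable def multilinear (g : Finset E → ℝ) (y : E → ℝ) : ℝ := ∑ X, subsetWeight y X * g X

theorem coin_toReal {x : ℝ} (h0 : 0 ≤ x) (h1 : x ≤ 1) (b : Bool) :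
    (coin x b).toReal = if b = true then x else 1 - x := by
  have h : min 1 (ENNReal.ofReal x) = ENNReal.ofReal x :=
    min_eq_right (ENNReal.ofReal_le_one.2 h1)
  cases b
  · simp [coin, PMF.ofFintype_apply, h, ENNReal.toReal_sub_of_le (ENNReal.ofReal_le_one.2 h1),
      ENNReal.toReal_ofReal h0]
  · simp [coin, PMF.ofFintype_apply, h, ENNReal.toReal_ofReal h0]

theorem mean_randomSubset {y : E → ℝ} (h0 : ∀ e, 0 ≤ y e) (h1 : ∀ e, y e ≤ 1)
    (g : Finset E → ℝ) : (randomSubset y).mean g = multilinear g y := by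
  rw [randomSubset, PMF.mean_map, PMF.mean, multilinear]
  refine Fintype.sum_equiv
    ⟨fun b => Finset.univ.filter fun e => b e = true, fun X e => decide (e ∈ X),
      fun b => by funext e; simp, fun X => by ext e; simp⟩ _ _ fun b => ?_
  simp only [indepPMF, PMF.ofFintype_apply, ENNReal.toReal_prod, coin_toReal (h0 _) (h1 _),
    subsetWeight, Equiv.coe_fn_mk, Finset.mem_filter, Finset.mem_univ, true_and,
    Function.comp_apply]

/-- Conditioning on all coordinates but `e` exhibits the extension as an affine function of `y e`.
-/
theorem multilinear_eq_sum_erase (g : Finset E → ℝ) (y : E → ℝ) (e : E) :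
    multilinear g y = ∑ X ∈ (Finset.univ.erase e).powerset,
      (∏ i ∈ Finset.univ.erase e, if i ∈ X then y i else 1 - y i)
        * ((1 - y e) * g X + y e * g (insert e X)) := by
  have he : e ∉ Finset.univ.erase e := Finset.notMem_erase e _
  rw [multilinear, ← Finset.powerset_univ, ← Finset.insert_erase (Finset.mem_univ e),
    Finset.sum_powerset_insert he, ← Finset.sum_add_distrib,
    Finset.insert_erase (Finset.mem_univ e)]
  refine Finset.sum_congr rfl fun X hX => ?_
  have heX : e ∉ X := fun h => he (Finset.mem_powerset.1 hX h)
  rw [subsetWeight, subsetWeight, ← Finset.mul_prod_erase _ _ (Finset.mem_univ e),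
    ← Finset.mul_prod_erase _ _ (Finset.mem_univ e), if_neg heX, if_pos (Finset.mem_insert_self e X)]
  have : ∏ i ∈ Finset.univ.erase e, (if i ∈ insert e X then y i else 1 - y i)
      = ∏ i ∈ Finset.univ.erase e, if i ∈ X then y i else 1 - y i := by
    refine Finset.prod_congr rfl fun i hi => ?_
    simp [Finset.mem_insert, Finset.ne_of_mem_erase hi]
  rw [this]
  ring

/-- The discrete derivative of a set function at the element `e`. -/
def marginalGain (f : Finset E → ℝ) (e : E) (X : Finset E) : ℝ := f (insert e X) - f (X.erase e)

/-- Affinity in the coordinate `e` makes the first-order expansion exact; the slope does not depend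
on that coordinate, since `marginalGain g e` ignores whether `e` is in the set. -/
theorem multilinear_sub_of_eq_off (g : Finset E → ℝ) {y z : E → ℝ} (e : E)
    (h : ∀ i, i ≠ e → y i = z i) :
    multilinear g z - multilinear g y = (z e - y e) * multilinear (marginalGain g e) z := by
  rw [multilinear_eq_sum_erase g z e, multilinear_eq_sum_erase g y e,
    multilinear_eq_sum_erase (marginalGain g e) z e, ← Finset.sum_sub_distrib, Finset.mul_sum]
  refine Finset.sum_congr rfl fun X hX => ?_
  have heX : e ∉ X := fun h => Finset.notMem_erase e _ (Finset.mem_powerset.1 hX h)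
  have : ∏ i ∈ Finset.univ.erase e, (if i ∈ X then y i else 1 - y i)
      = ∏ i ∈ Finset.univ.erase e, if i ∈ X then z i else 1 - z i :=
    Finset.prod_congr rfl fun i hi => by rw [h i (Finset.ne_of_mem_erase hi)]
  simp only [this, marginalGain, Finset.insert_idem, Finset.erase_insert heX,
    Finset.erase_eq_of_notMem heX]
  ring

theorem multilinear_mono {g h : Finset E → ℝ} {y : E → ℝ} (h0 : ∀ e, 0 ≤ y e)
    (h1 : ∀ e, y e ≤ 1) (H : ∀ X, g X ≤ h X) : multilinear g y ≤ multilinear h y := by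
  rw [← mean_randomSubset h0 h1, ← mean_randomSubset h0 h1]
  exact PMF.mean_mono H

theorem multilinear_const {y : E → ℝ} (h0 : ∀ e, 0 ≤ y e) (h1 : ∀ e, y e ≤ 1) (c : ℝ) :
    multilinear (fun _ => c) y = c := by
  rw [← mean_randomSubset h0 h1, PMF.mean_const]

/-- Changing the coordinates one after the other, if each single change raises a multilinear
extension at a rate at least `c e`, then so does the whole change. -/
theorem sum_mul_le_multilinear_sub (g : Finset E → ℝ) {y z : E → ℝ} (hy : ∀ e, 0 ≤ y e)
    (hyz : ∀ e, y e ≤ z e) (c : E → ℝ)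
    (hc : ∀ v : E → ℝ, (∀ e, 0 ≤ v e) → (∀ e, v e ≤ z e) →
      ∀ e, c e ≤ multilinear (marginalGain g e) v) :
    ∑ e, (z e - y e) * c e ≤ multilinear g z - multilinear g y := by
  have key : ∀ s : Finset E, ∑ e ∈ s, (z e - y e) * c e
      ≤ multilinear g (fun i => if i ∈ s then z i else y i) - multilinear g y := by
    intro s
    induction s using Finset.induction_on with
    | empty => simp
    | insert a s ha ih =>
      have h := multilinear_sub_of_eq_off g (y := fun i => if i ∈ s then z i else y i)
        (z := fun i => if i ∈ insert a s then z i else y i) a (fun i hi => by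
          simp [Finset.mem_insert, hi])
      have h' := hc (fun i => if i ∈ insert a s then z i else y i)
        (fun e => by split_ifs; exacts [(hy e).trans (hyz e), hy e])
        (fun e => by split_ifs; exacts [le_rfl, hyz e]) a
      have h'' := mul_le_mul_of_nonneg_left h' (sub_nonneg.2 (hyz a))
      rw [Finset.sum_insert ha]
      simp only [Finset.mem_insert_self, if_true, if_neg ha] at h
      linarith
  simpa using key Finset.univ

theorem multilinear_neg (g : Finset E → ℝ) (y : E → ℝ) :
    multilinear (fun X => -g X) y = -multilinear g y := by
  simp [multilinear]

/-- The discrete derivatives of `-g` are nonnegative, so its extension cannot decrease when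
coordinates are raised one by one. -/
theorem multilinear_antitone {g : Finset E → ℝ} (hg : Antitone g) {y z : E → ℝ}
    (hy : ∀ e, 0 ≤ y e) (hyz : ∀ e, y e ≤ z e) (hz : ∀ e, z e ≤ 1) :
    multilinear g z ≤ multilinear g y := by
  have h := sum_mul_le_multilinear_sub (fun X => -g X) hy hyz (fun _ => 0)
    (fun v hv hvz e => by
      have hv1 : ∀ e, v e ≤ 1 := fun e => (hvz e).trans (hz e)
      rw [← multilinear_const hv hv1 0]
      refine multilinear_mono hv hv1 fun X => ?_
      have := hg ((Finset.erase_subset e X).trans (Finset.subset_insert e X))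
      simp only [marginalGain]
      linarith)
  simp only [mul_zero, Finset.sum_const_zero, multilinear_neg] at h
  linarith

theorem multilinear_mem {y : E → ℝ} (h0 : ∀ e, 0 ≤ y e) (h1 : ∀ e, y e ≤ 1) (e : E) :
    multilinear (fun X => if e ∈ X then 1 else 0) y = y e := by
  rw [multilinear_eq_sum_erase _ y e]
  have h := multilinear_const h0 h1 1
  rw [multilinear_eq_sum_erase _ y e] at h
  calc _ = ∑ X ∈ (Finset.univ.erase e).powerset, y e *
        ((∏ i ∈ Finset.univ.erase e, if i ∈ X then y i else 1 - y i)
        * ((1 - y e) * 1 + y e * 1)) := by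
        refine Finset.sum_congr rfl fun X hX => ?_
        have heX : e ∉ X := fun h => Finset.notMem_erase e _ (Finset.mem_powerset.1 hX h)
        simp only [heX, if_false, Finset.mem_insert_self, if_true]
        ring
    _ = y e := by rw [← Finset.mul_sum, h, mul_one]

end Multilinear

/-! ### Monotone submodular functions and their extensions. -/

section Submodular

variable {E : Type*} [DecidableEq E] {f : Finset E → ℝ}

theorem marginalGain_nonneg (hf : Monotone f) (e : E) (X : Finset E) : 0 ≤ marginalGain f e X :=
  sub_nonneg.2 (hf ((Finset.erase_subset e X).trans (Finset.subset_insert e X)))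

theorem marginalGain_antitone (hs : ∀ X Y, f (X ∪ Y) + f (X ∩ Y) ≤ f X + f Y) (e : E) :
    Antitone (marginalGain f e) := by
  intro X Y hXY
  have h := hs (insert e X) (Y.erase e)
  have h1 : insert e X ∪ Y.erase e = insert e Y := by
    ext i
    have := @hXY i
    simp only [Finset.mem_union, Finset.mem_insert, Finset.mem_erase]
    tauto
  have h2 : insert e X ∩ Y.erase e = X.erase e := by
    ext i
    have := @hXY i
    simp only [Finset.mem_inter, Finset.mem_insert, Finset.mem_erase]
    tauto
  rw [h1, h2] at h
  simp only [marginalGain]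
  linarith

theorem marginalGain_le (hs : ∀ X Y, f (X ∪ Y) + f (X ∩ Y) ≤ f X + f Y) (e : E) (X : Finset E) :
    marginalGain f e X ≤ f {e} - f ∅ :=
  (marginalGain_antitone hs e (Finset.empty_subset X)).trans_eq (by simp [marginalGain])

/-- By diminishing returns, adding the elements of `Z` to `X` one at a time gains no more than
adding each to `X` alone. Measuring gains from `X.erase a` instead of `X` only enlarges them, by
monotonicity. -/
theorem le_add_sum_marginalGain (hf : Monotone f)
    (hs : ∀ X Y, f (X ∪ Y) + f (X ∩ Y) ≤ f X + f Y) (X Z : Finset E) :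
    f Z ≤ f X + ∑ e ∈ Z, marginalGain f e X := by
  refine (hf (Finset.subset_union_right (s₁ := X))).trans ?_
  induction Z using Finset.induction_on with
  | empty => simp
  | insert a Z ha ih =>
    have h := hs (X ∪ Z) (insert a X)
    have h1 : X ∪ Z ∪ insert a X = X ∪ insert a Z := by
      ext i
      simp only [Finset.mem_union, Finset.mem_insert]
      tauto
    have h2 : f X ≤ f ((X ∪ Z) ∩ insert a X) :=
      hf (Finset.subset_inter Finset.subset_union_left (Finset.subset_insert a X))
    have h3 : f (X.erase a) ≤ f X := hf (Finset.erase_subset a X)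
    rw [h1] at h
    rw [Finset.sum_insert ha]
    simp only [marginalGain] at ih ⊢
    linarith

variable [Fintype E]

theorem le_multilinear_add_sum (hf : Monotone f)
    (hs : ∀ X Y, f (X ∪ Y) + f (X ∩ Y) ≤ f X + f Y) {y : E → ℝ} (h0 : ∀ e, 0 ≤ y e)
    (h1 : ∀ e, y e ≤ 1) (Z : Finset E) :
    f Z ≤ multilinear f y + ∑ e ∈ Z, multilinear (marginalGain f e) y := by
  simp only [← mean_randomSubset h0 h1]
  rw [← PMF.mean_sum, ← PMF.mean_add]
  exact (PMF.mean_const _ _).ge.trans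
    (PMF.mean_mono fun X => le_add_sum_marginalGain hf hs X Z)

/-- Average the bound of `f X` by its linearization at `∅`; the indicator of `e ∈ X` has mean `y e`.
-/
theorem multilinear_le_add_sum (hf : Monotone f)
    (hs : ∀ X Y, f (X ∪ Y) + f (X ∩ Y) ≤ f X + f Y) {y : E → ℝ} (h0 : ∀ e, 0 ≤ y e)
    (h1 : ∀ e, y e ≤ 1) :
    multilinear f y ≤ f ∅ + ∑ e, y e * (f {e} - f ∅) := by
  have h : ∀ X, f X ≤ f ∅ + ∑ e, (f {e} - f ∅) * (if e ∈ X then 1 else 0) := fun X => by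
    refine (le_add_sum_marginalGain hf hs ∅ X).trans_eq ?_
    simp [marginalGain]
  refine (multilinear_mono h0 h1 h).trans_eq ?_
  rw [← mean_randomSubset h0 h1, PMF.mean_add, PMF.mean_const, PMF.mean_sum]
  congr 1
  refine Finset.sum_congr rfl fun e _ => ?_
  rw [PMF.mean_mul_left, mean_randomSubset h0 h1, multilinear_mem h0 h1, mul_comm]

/-- A multilinear extension of a submodular function is concave in nonnegative directions. -/
theorem sum_mul_gradient_le_multilinear_sub
    (hs : ∀ X Y, f (X ∪ Y) + f (X ∩ Y) ≤ f X + f Y) {y z : E → ℝ} (hy : ∀ e, 0 ≤ y e)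
    (hyz : ∀ e, y e ≤ z e) (hz : ∀ e, z e ≤ 1) :
    ∑ e, (z e - y e) * multilinear (marginalGain f e) z ≤ multilinear f z - multilinear f y :=
  sum_mul_le_multilinear_sub f hy hyz _ fun _ hv hvz e =>
    multilinear_antitone (marginalGain_antitone hs e) hv hvz hz

theorem multilinear_marginalGain_mem_Icc (hf : Monotone f)
    (hs : ∀ X Y, f (X ∪ Y) + f (X ∩ Y) ≤ f X + f Y) {y : E → ℝ} (h0 : ∀ e, 0 ≤ y e)
    (h1 : ∀ e, y e ≤ 1) (e : E) :
    multilinear (marginalGain f e) y ∈ Set.Icc 0 (f {e} - f ∅) := by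
  constructor
  · rw [← multilinear_const h0 h1 0]
    exact multilinear_mono h0 h1 (marginalGain_nonneg hf e)
  · rw [← multilinear_const h0 h1 (f {e} - f ∅)]
    exact multilinear_mono h0 h1 (marginalGain_le hs e)

end Submodular

/-! ### Trajectories and visiting probabilities. -/

namespace SubmodularMDP

variable {S A : Type*} [DecidableEq S] [DecidableEq A]

/-- The law of the set of the next `k` state-action pairs. -/
noncomputable def rolloutSet (M : SubmodularMDP S A) (π : Policy S A) (k : ℕ) (hist : List S)
    (s : S) : PMF (Finset (S × A)) :=
  (M.rollout π k hist s).map List.toFinset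

theorem rolloutSet_zero (M : SubmodularMDP S A) (π : Policy S A) (hist : List S) (s : S) :
    M.rolloutSet π 0 hist s = PMF.pure ∅ := by
  simp [rolloutSet, rollout, PMF.pure_map]

theorem rolloutSet_succ (M : SubmodularMDP S A) (π : Policy S A) (k : ℕ) (hist : List S) (s : S) :
    M.rolloutSet π (k + 1) hist s = (π (hist ++ [s])).bind fun a => (M.P s a).bind fun s' =>
      (M.rolloutSet π k (hist ++ [s]) s').map (insert (s, a)) := by
  simp only [rolloutSet, rollout, PMF.map_bind, PMF.map_comp]
  congr! 5
  funext tr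
  simp

theorem visited_eq_rolloutSet (M : SubmodularMDP S A) (π : Policy S A) :
    M.visited π = M.rolloutSet π M.H [] M.s₁ := rfl

theorem card_le_of_mem_support_rolloutSet (M : SubmodularMDP S A) (π : Policy S A) (k : ℕ)
    (hist : List S) (s : S) {Z : Finset (S × A)} (hZ : Z ∈ (M.rolloutSet π k hist s).support) :
    Z.card ≤ k := by
  induction k generalizing hist s Z with
  | zero =>
    rw [rolloutSet_zero, PMF.mem_support_pure_iff] at hZ
    simp [hZ]
  | succ k ih =>
    simp only [rolloutSet_succ, PMF.mem_support_bind_iff, PMF.mem_support_map_iff] at hZ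
    obtain ⟨a, -, s', -, Z', hZ', rfl⟩ := hZ
    exact (Finset.card_insert_le _ _).trans (Nat.succ_le_succ (ih _ _ hZ'))

theorem nonempty_of_mem_support_visited (M : SubmodularMDP S A) (π : Policy S A)
    {Z : Finset (S × A)} (hZ : Z ∈ (M.visited π).support) : Z.Nonempty := by
  obtain ⟨k, hk⟩ := Nat.exists_eq_succ_of_ne_zero M.H_pos.ne'
  rw [visited_eq_rolloutSet, hk, Nat.succ_eq_add_one] at hZ
  simp only [rolloutSet_succ, PMF.mem_support_bind_iff, PMF.mem_support_map_iff] at hZ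
  obtain ⟨a, -, s', -, Z', hZ', rfl⟩ := hZ
  exact Finset.insert_nonempty _ _

theorem level_succ (M : SubmodularMDP S A) {k : ℕ} {s s' : S} {a : A}
    (hs : M.level s + (k + 1) = M.H) (hs' : s' ∈ (M.P s a).support) (hk : 0 < k) :
    M.level s' + k = M.H := by
  have := M.level_step s a s' (by omega) hs'
  omega

/-- Later pairs lie on strictly later levels, so no pair repeats. The level condition is required
only for `0 < k`, because the state drawn after the last action has an unconstrained level. -/
theorem le_level_of_mem_support_rolloutSet (M : SubmodularMDP S A) (π : Policy S A) (k : ℕ)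
    (hist : List S) (s : S) (hs : 0 < k → M.level s + k = M.H) {Z : Finset (S × A)}
    (hZ : Z ∈ (M.rolloutSet π k hist s).support) {e : S × A} (he : e ∈ Z) :
    M.H ≤ M.level e.1 + k := by
  induction k generalizing hist s Z with
  | zero =>
    rw [rolloutSet_zero, PMF.mem_support_pure_iff] at hZ
    simp [hZ] at he
  | succ k ih =>
    simp only [rolloutSet_succ, PMF.mem_support_bind_iff, PMF.mem_support_map_iff] at hZ
    obtain ⟨a, -, s', hs', Z', hZ', rfl⟩ := hZ
    have hs := hs (Nat.succ_pos k)
    rcases Finset.mem_insert.1 he with rfl | he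
    · exact hs.ge
    · have := ih _ _ (M.level_succ hs hs') hZ' he
      omega

variable [Fintype S] [Fintype A]

theorem value_eq_mean (M : SubmodularMDP S A) (π : Policy S A) :
    M.value π = (M.visited π).mean M.f := rfl

theorem marginal_eq_mean (M : SubmodularMDP S A) (π : Policy S A) (e : S × A) :
    M.marginal π e = (M.visited π).mean fun Z => if e ∈ Z then 1 else 0 := by
  simp [marginal, PMF.mean, Finset.sum_filter]

theorem marginal_nonneg (M : SubmodularMDP S A) (π : Policy S A) (e : S × A) :
    0 ≤ M.marginal π e := by
  rw [marginal_eq_mean]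
  exact PMF.mean_nonneg fun Z => by split_ifs <;> norm_num

theorem marginal_le_one (M : SubmodularMDP S A) (π : Policy S A) (e : S × A) :
    M.marginal π e ≤ 1 := by
  rw [marginal_eq_mean]
  refine (PMF.mean_mono fun Z => ?_).trans_eq (PMF.mean_const _ 1)
  split_ifs <;> norm_num

/-- The inner product `x(π) · w`. -/
noncomputable def additiveValue (M : SubmodularMDP S A) (π : Policy S A) (w : S × A → ℝ) : ℝ :=
  ∑ e, M.marginal π e * w e

theorem additiveValue_eq_mean (M : SubmodularMDP S A) (π : Policy S A) (w : S × A → ℝ) :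
    M.additiveValue π w = (M.visited π).mean fun Z => ∑ e ∈ Z, w e := by
  have h : (fun Z : Finset (S × A) => ∑ e ∈ Z, w e)
      = fun Z => ∑ e, w e * if e ∈ Z then 1 else 0 := by
    funext Z
    simp
  rw [h, PMF.mean_sum, additiveValue]
  refine Finset.sum_congr rfl fun e _ => ?_
  rw [PMF.mean_mul_left, marginal_eq_mean, mul_comm]

theorem value_le_multilinear_add (M : SubmodularMDP S A) (π : Policy S A) {y : S × A → ℝ}
    (h0 : ∀ e, 0 ≤ y e) (h1 : ∀ e, y e ≤ 1) :
    M.value π ≤ multilinear M.f y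
      + M.additiveValue π fun e => multilinear (marginalGain M.f e) y := by
  rw [additiveValue_eq_mean, value_eq_mean, ← PMF.mean_const_add]
  exact PMF.mean_mono (le_multilinear_add_sum M.f_mono M.f_submodular h0 h1)

theorem value_nonneg (M : SubmodularMDP S A) (π : Policy S A) : 0 ≤ M.value π :=
  PMF.mean_nonneg M.f_nonneg

theorem randomValue_nonneg (M : SubmodularMDP S A) (ρ : PMF (Policy S A)) :
    0 ≤ M.randomValue ρ :=
  PMF.mean_nonneg M.f_nonneg

theorem value_le_univ (M : SubmodularMDP S A) (π : Policy S A) : M.value π ≤ M.f Finset.univ :=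
  (PMF.mean_mono fun Z => M.f_mono _ _ (Finset.subset_univ Z)).trans_eq (PMF.mean_const _ _)

/-- A trajectory through `e` is worth at least `f {e}`, and any other at least 0. -/
theorem marginal_mul_le_value (M : SubmodularMDP S A) (π : Policy S A) (e : S × A) :
    M.marginal π e * (M.f {e} - M.f ∅) ≤ M.value π := by
  rw [marginal_eq_mean, mul_comm, ← PMF.mean_mul_left, value_eq_mean]
  refine PMF.mean_mono fun Z => ?_
  split_ifs with h
  · have h1 := M.f_mono _ _ (Finset.singleton_subset_iff.2 h)
    have h2 := M.f_nonneg ∅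
    linarith
  · simpa using M.f_nonneg Z

/-- The horizon times the value dominates the sum of the values of the single pairs. -/
theorem add_additiveValue_le_horizon_mul_value (M : SubmodularMDP S A) (π : Policy S A) :
    M.f ∅ + M.additiveValue π (fun e => M.f {e} - M.f ∅) ≤ M.H * M.value π := by
  rw [additiveValue_eq_mean, value_eq_mean, ← PMF.mean_const_add, ← PMF.mean_mul_left]
  refine PMF.mean_le_mean_of_support fun Z hZ => ?_
  have hcard : (Z.card : ℝ) ≤ M.H :=
    Nat.cast_le.2 (M.card_le_of_mem_support_rolloutSet π M.H [] M.s₁ hZ)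
  -- Since `Z` is nonempty, the copies of `f ∅` subtracted in the sum outweigh the single one added.
  have hone : (1 : ℝ) ≤ Z.card :=
    Nat.one_le_cast.2 (Finset.card_pos.2 (M.nonempty_of_mem_support_visited π hZ))
  have hsum : ∑ e ∈ Z, M.f {e} ≤ Z.card * M.f Z := by
    rw [← nsmul_eq_mul]
    exact Finset.sum_le_card_nsmul _ _ _ fun e he =>
      M.f_mono _ _ (Finset.singleton_subset_iff.2 he)
  rw [Finset.sum_sub_distrib, Finset.sum_const, nsmul_eq_mul]
  have h1 := mul_le_mul_of_nonneg_right hcard (M.f_nonneg Z)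
  have h2 := mul_le_mul_of_nonneg_right hone (M.f_nonneg ∅)
  linarith

/-- The Bellman recursion for a reward summed over the visited set: it holds because the present
pair does not recur later, so inserting it adds exactly its reward. -/
theorem mean_rolloutSet_succ (M : SubmodularMDP S A) (π : Policy S A) (w : S × A → ℝ) (k : ℕ)
    (hist : List S) (s : S) (hs : M.level s + (k + 1) = M.H) :
    (M.rolloutSet π (k + 1) hist s).mean (fun Z => ∑ e ∈ Z, w e)
      = (π (hist ++ [s])).mean fun a => w (s, a) + (M.P s a).mean fun s' =>
        (M.rolloutSet π k (hist ++ [s]) s').mean fun Z => ∑ e ∈ Z, w e := by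
  rw [rolloutSet_succ, PMF.mean_bind]
  congr 1
  funext a
  rw [PMF.mean_bind, ← PMF.mean_const_add]
  refine PMF.mean_congr_of_support fun s' hs' => ?_
  rw [PMF.mean_map, ← PMF.mean_const_add]
  refine PMF.mean_congr_of_support fun Z hZ => ?_
  have hmem : (s, a) ∉ Z := fun h => by
    have := M.le_level_of_mem_support_rolloutSet π k _ _ (M.level_succ hs hs') hZ h
    simp only at this
    omega
  rw [Function.comp_apply, Finset.sum_insert hmem]

/-! ### Optimality of backward induction. -/

section DynamicProgramming

variable [Nonempty A]

theorem mean_rolloutSet_le_dpValue (M : SubmodularMDP S A) (π : Policy S A) (w : S × A → ℝ)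
    (k : ℕ) (hist : List S) (s : S) (hs : 0 < k → M.level s + k = M.H) :
    (M.rolloutSet π k hist s).mean (fun Z => ∑ e ∈ Z, w e) ≤ M.dpValue w k s := by
  induction k generalizing hist s with
  | zero => simp [rolloutSet_zero, PMF.mean_pure, dpValue]
  | succ k ih =>
    have hs := hs (Nat.succ_pos k)
    rw [M.mean_rolloutSet_succ π w k hist s hs]
    refine (PMF.mean_mono fun a => ?_).trans_eq (PMF.mean_const _ (M.dpValue w (k + 1) s))
    refine le_trans ?_ (Finset.le_sup' (fun a => w (s, a)
      + ∑ s', (M.P s a s').toReal * M.dpValue w k s') (Finset.mem_univ a))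
    exact add_le_add le_rfl
      (PMF.mean_le_mean_of_support fun s' hs' => ih _ s' (M.level_succ hs hs'))

theorem mean_rolloutSet_dpPolicy (M : SubmodularMDP S A) {arg : S → (A → ℝ) → A}
    (harg : ∀ s (q : A → ℝ) a, q a ≤ q (arg s q)) (w : S × A → ℝ)
    (k : ℕ) (hist : List S) (s : S) (hs : 0 < k → M.level s + k = M.H) :
    (M.rolloutSet (M.ofDet (M.dpPolicy arg w)) k hist s).mean (fun Z => ∑ e ∈ Z, w e)
      = M.dpValue w k s := by
  induction k generalizing hist s with
  | zero => simp [rolloutSet_zero, PMF.mean_pure, dpValue]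
  | succ k ih =>
    have hs := hs (Nat.succ_pos k)
    rw [M.mean_rolloutSet_succ _ w k hist s hs, ofDet, PMF.mean_pure]
    have hlast : (hist ++ [s]).getLastD M.s₁ = s := by simp
    have hlevel : M.H - 1 - M.level s = k := by omega
    rw [hlast]
    set a := M.dpPolicy arg w s with ha
    have hmean : ((M.P s a).mean fun s' => (M.rolloutSet (M.ofDet (M.dpPolicy arg w)) k
        (hist ++ [s]) s').mean fun Z => ∑ e ∈ Z, w e) = (M.P s a).mean (M.dpValue w k) :=
      PMF.mean_congr_of_support fun s' hs' => ih _ s' (M.level_succ hs hs')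
    refine (congrArg (w (s, a) + ·) hmean).trans (le_antisymm ?_ ?_)
    · exact Finset.le_sup' (fun a => w (s, a)
        + ∑ s', (M.P s a s').toReal * M.dpValue w k s') (Finset.mem_univ a)
    · refine Finset.sup'_le _ _ fun b _ => ?_
      have h := harg s (M.dpQ w k s) b
      rw [ha, dpPolicy, hlevel]
      exact h

theorem additiveValue_le_dpValue (M : SubmodularMDP S A) (π : Policy S A) (w : S × A → ℝ) :
    M.additiveValue π w ≤ M.dpValue w M.H M.s₁ := by
  rw [additiveValue_eq_mean]
  exact M.mean_rolloutSet_le_dpValue π w M.H [] M.s₁ fun _ => by rw [M.level_init, zero_add]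

theorem additiveValue_dpPolicy (M : SubmodularMDP S A) {arg : S → (A → ℝ) → A}
    (harg : ∀ s (q : A → ℝ) a, q a ≤ q (arg s q)) (w : S × A → ℝ) :
    M.additiveValue (M.ofDet (M.dpPolicy arg w)) w = M.dpValue w M.H M.s₁ := by
  rw [additiveValue_eq_mean]
  exact M.mean_rolloutSet_dpPolicy harg w M.H [] M.s₁ fun _ => by rw [M.level_init, zero_add]

end DynamicProgramming

end SubmodularMDP

/-! ### Step size and sample size. -/

section Parameters

variable (S A : Type*) [Fintype S] [Fintype A]

theorem stepSize_nonneg : 0 ≤ stepSize S A := by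
  unfold stepSize
  positivity

theorem numSteps_mul_stepSize [Nonempty S] [Nonempty A] : (numSteps S A : ℝ) * stepSize S A = 1 := by
  have hS : (0 : ℝ) < Fintype.card S := Nat.cast_pos.2 Fintype.card_pos
  have hA : (0 : ℝ) < Fintype.card A := Nat.cast_pos.2 Fintype.card_pos
  rw [numSteps, stepSize]
  push_cast
  field_simp

theorem stepSize_pos [Nonempty S] [Nonempty A] : 0 < stepSize S A := by
  have hS : (0 : ℝ) < Fintype.card S := Nat.cast_pos.2 Fintype.card_pos
  have hA : (0 : ℝ) < Fintype.card A := Nat.cast_pos.2 Fintype.card_pos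
  unfold stepSize
  positivity

theorem stepSize_le_one [Nonempty S] [Nonempty A] : stepSize S A ≤ 1 := by
  have hT : (1 : ℝ) ≤ numSteps S A := by
    refine Nat.one_le_cast.2 (Nat.pos_of_ne_zero fun h => ?_)
    have := numSteps_mul_stepSize S A
    simp [h] at this
  have := mul_le_mul_of_nonneg_right hT (stepSize_nonneg S A)
  rwa [one_mul, numSteps_mul_stepSize] at this

/-- The factor 10(1 + log n) is only used through being at least 1: mean errors suffice, so the
logarithm that a union bound would need plays no role. -/
theorem one_div_sq_stepSize_le_numSamples [Nonempty S] [Nonempty A] :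
    1 / stepSize S A ^ 2 ≤ numSamples S A := by
  refine le_trans ?_ (Nat.le_ceil _)
  have hδ := stepSize_pos S A
  have hlog : 0 ≤ Real.log ((Fintype.card S : ℝ) * Fintype.card A) := by
    rw [← Nat.cast_mul]
    exact Real.log_natCast_nonneg _
  gcongr
  linarith

theorem numSamples_pos [Nonempty S] [Nonempty A] : 0 < numSamples S A := by
  have h := one_div_sq_stepSize_le_numSamples S A
  have hδ := stepSize_pos S A
  exact Nat.cast_pos.1 (lt_of_lt_of_le (by positivity) h)

theorem one_div_sqrt_numSamples_le [Nonempty S] [Nonempty A] :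
    1 / √(numSamples S A : ℝ) ≤ stepSize S A := by
  have hδ := stepSize_pos S A
  rw [one_div_le (Real.sqrt_pos.2 (Nat.cast_pos.2 (numSamples_pos S A))) hδ]
  refine Real.le_sqrt_of_sq_le ?_
  rw [div_pow, one_pow]
  exact one_div_sq_stepSize_le_numSamples S A

end Parameters

/-! ### Progress and regret of continuous greedy. -/

namespace SubmodularMDP

variable {S A : Type*} [DecidableEq S] [DecidableEq A] [Fintype S] [Fintype A]

/-- The gradient of the multilinear extension of the objective. -/
noncomputable def gradient (M : SubmodularMDP S A) (y : S × A → ℝ) (e : S × A) : ℝ :=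
  multilinear (marginalGain M.f e) y

theorem gradient_mem_Icc (M : SubmodularMDP S A) {y : S × A → ℝ} (h0 : ∀ e, 0 ≤ y e)
    (h1 : ∀ e, y e ≤ 1) (e : S × A) : M.gradient y e ∈ Set.Icc 0 (M.f {e} - M.f ∅) :=
  multilinear_marginalGain_mem_Icc M.f_mono M.f_submodular h0 h1 e

theorem position_nonneg (M : SubmodularMDP S A) {k : ℕ} (d : Fin k → S → A) (e : S × A) :
    0 ≤ M.position d e :=
  Finset.sum_nonneg fun _ _ => mul_nonneg (stepSize_nonneg S A) (M.marginal_nonneg _ e)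

theorem position_succ (M : SubmodularMDP S A) {k : ℕ} (d : Fin (k + 1) → S → A) (e : S × A) :
    M.position d e = M.position (fun i => d i.castSucc) e
      + stepSize S A * M.marginal (M.ofDet (d (Fin.last k))) e :=
  Fin.sum_univ_castSucc _

variable [Nonempty A]

theorem position_le_one (M : SubmodularMDP S A) {k : ℕ} (hk : k ≤ numSteps S A)
    (d : Fin k → S → A) (e : S × A) : M.position d e ≤ 1 := by
  have : Nonempty S := ⟨M.s₁⟩
  calc M.position d e ≤ ∑ _i : Fin k, stepSize S A :=
        Finset.sum_le_sum fun i _ =>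
          mul_le_of_le_one_right (stepSize_nonneg S A) (M.marginal_le_one _ e)
    _ = k * stepSize S A := by simp
    _ ≤ numSteps S A * stepSize S A :=
        mul_le_mul_of_nonneg_right (Nat.cast_le.2 hk) (stepSize_nonneg S A)
    _ = 1 := numSteps_mul_stepSize S A

/-- The accumulated loss against exact maximization of the linearized objective. -/
noncomputable def regret (M : SubmodularMDP S A) : (k : ℕ) → (Fin k → S → A) → ℝ
  | 0, _ => 0
  | k + 1, d => M.regret k (fun i => d i.castSucc) + stepSize S A *
      (M.dpValue (M.gradient (M.position fun i => d i.castSucc)) M.H M.s₁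
        - M.additiveValue (M.ofDet (d (Fin.last k)))
            (M.gradient (M.position fun i => d i.castSucc)))

theorem regret_nonneg (M : SubmodularMDP S A) (k : ℕ) (d : Fin k → S → A) :
    0 ≤ M.regret k d := by
  induction k with
  | zero => exact le_rfl
  | succ k ih => exact add_nonneg (ih _) (mul_nonneg (stepSize_nonneg S A)
      (sub_nonneg.2 (M.additiveValue_le_dpValue _ _)))

/-- The progress of continuous greedy along any sequence of policies, in terms of its regret. -/
theorem sub_multilinear_position_le (M : SubmodularMDP S A) {opt : ℝ}
    (hopt : ∀ c, (∀ π, M.value π ≤ c) → opt ≤ c) {m : S × A → ℝ}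
    (hm : ∀ π e, M.marginal π e ≤ m e) (k : ℕ) (hk : k ≤ numSteps S A) (d : Fin k → S → A) :
    opt - multilinear M.f (M.position d) ≤ (1 - stepSize S A) ^ k * opt + M.regret k d
      + stepSize S A * ∑ e, m e * (M.gradient (fun _ => 0) e - M.gradient (M.position d) e) := by
  have : Nonempty S := ⟨M.s₁⟩
  have hδ0 := stepSize_nonneg S A
  have hδ1 := stepSize_le_one S A
  have hm0 : ∀ e, 0 ≤ m e := fun e =>
    (M.marginal_nonneg (fun _ => PMF.pure (Classical.arbitrary A)) e).trans (hm _ e)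
  induction k with
  | zero =>
    have hpos : M.position d = fun _ => 0 := by
      funext e
      simp [position]
    have hF : 0 ≤ multilinear M.f fun _ => 0 :=
      (multilinear_const (fun _ => le_rfl) (fun _ => zero_le_one) 0).ge.trans
        (multilinear_mono (fun _ => le_rfl) (fun _ => zero_le_one) M.f_nonneg)
    simp only [hpos, regret, sub_self, mul_zero, Finset.sum_const_zero]
    linarith
  | succ k ih =>
    set d' : Fin k → S → A := fun i => d i.castSucc with hd'
    set π := M.ofDet (d (Fin.last k)) with hπ
    set y := M.position d' with hy
    set z := M.position d with hz
    set g := M.gradient y with hg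
    set g' := M.gradient z with hg'
    have ih := ih (Nat.le_of_succ_le hk) d'
    have hy0 : ∀ e, 0 ≤ y e := M.position_nonneg d'
    have hy1 : ∀ e, y e ≤ 1 := M.position_le_one (Nat.le_of_succ_le hk) d'
    have hz1 : ∀ e, z e ≤ 1 := M.position_le_one hk d
    have hzy : ∀ e, z e - y e = stepSize S A * M.marginal π e := fun e => by
      rw [hz, M.position_succ d e]
      ring
    have hyz : ∀ e, y e ≤ z e := fun e =>
      sub_nonneg.1 ((mul_nonneg hδ0 (M.marginal_nonneg π e)).trans_eq (hzy e).symm)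
    have hgg : ∀ e, g' e ≤ g e := fun e =>
      multilinear_antitone (marginalGain_antitone M.f_submodular e) hy0 hyz hz1
    have hg0 : ∀ e, g e ≤ M.gradient (fun _ => 0) e := fun e =>
      multilinear_antitone (marginalGain_antitone M.f_submodular e) (fun _ => le_rfl) hy0 hy1
    have hgain : stepSize S A * M.additiveValue π g' ≤ multilinear M.f z - multilinear M.f y := by
      refine le_trans (le_of_eq ?_)
        (sum_mul_gradient_le_multilinear_sub M.f_submodular hy0 hyz hz1)
      simp only [hzy, additiveValue, Finset.mul_sum, hg', gradient]
      exact Finset.sum_congr rfl fun e _ => by ring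
    -- Gradients decrease along the step, so the marginals of `π` may be replaced by `m`; with
    -- weights independent of the step, the sum can telescope.
    have hcurv : M.additiveValue π g - M.additiveValue π g' ≤ ∑ e, m e * (g e - g' e) := by
      rw [additiveValue, additiveValue, ← Finset.sum_sub_distrib]
      refine Finset.sum_le_sum fun e _ => ?_
      rw [← mul_sub]
      exact mul_le_mul_of_nonneg_right (hm π e) (sub_nonneg.2 (hgg e))
    have hdp : opt ≤ multilinear M.f y + M.dpValue g M.H M.s₁ := hopt _ fun π' =>
      (M.value_le_multilinear_add π' hy0 hy1).trans
        (add_le_add le_rfl (M.additiveValue_le_dpValue π' g))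
    have hreg : M.regret (k + 1) d = M.regret k d' + stepSize S A *
      (M.dpValue g M.H M.s₁ - M.additiveValue π g) := rfl
    have hr0 := M.regret_nonneg k d'
    have hsum0 : 0 ≤ ∑ e, m e * (M.gradient (fun _ => 0) e - g e) :=
      Finset.sum_nonneg fun e _ => mul_nonneg (hm0 e) (sub_nonneg.2 (hg0 e))
    have hsplit : ∑ e, m e * (M.gradient (fun _ => 0) e - g' e)
        = ∑ e, m e * (M.gradient (fun _ => 0) e - g e) + ∑ e, m e * (g e - g' e) := by
      rw [← Finset.sum_add_distrib]
      exact Finset.sum_congr rfl fun e _ => by ring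
    rw [hreg, hsplit, pow_succ]
    have h1 := mul_le_mul_of_nonneg_left ih (sub_nonneg.2 hδ1)
    have h2 := mul_le_mul_of_nonneg_left hcurv hδ0
    have h3 := mul_le_mul_of_nonneg_left hdp hδ0
    -- The errors accumulated so far also shrink by `1 - δ`; this saving is discarded.
    have h4 := mul_nonneg hδ0 (add_nonneg hr0 (mul_nonneg hδ0 hsum0))
    linarith

/-- Exact optimization for a perturbed reward loses at most the weighted perturbation. -/
theorem dpValue_sub_additiveValue_dpPolicy_le (M : SubmodularMDP S A) {arg : S → (A → ℝ) → A}
    (harg : ∀ s (q : A → ℝ) a, q a ≤ q (arg s q)) {m : S × A → ℝ}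
    (hm : ∀ π e, M.marginal π e ≤ m e) (g w : S × A → ℝ) :
    M.dpValue g M.H M.s₁ - M.additiveValue (M.ofDet (M.dpPolicy arg w)) g
      ≤ ∑ e, m e * |w e - g e| := by
  have h := M.additiveValue_le_dpValue (M.ofDet (M.dpPolicy arg g)) w
  rw [← M.additiveValue_dpPolicy harg g]
  rw [← M.additiveValue_dpPolicy harg w] at h
  -- Adding the nonnegative advantage of the returned policy under `w` turns the loss into `(x' - x)
  -- · (w - g)`, and both marginals lie in `[0, m]`.
  refine (le_add_of_nonneg_right (sub_nonneg.2 h)).trans ?_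
  simp only [additiveValue]
  rw [← Finset.sum_sub_distrib, ← Finset.sum_sub_distrib, ← Finset.sum_add_distrib]
  refine Finset.sum_le_sum fun e _ => ?_
  have hx := M.marginal_nonneg (M.ofDet (M.dpPolicy arg g)) e
  have hx' := M.marginal_nonneg (M.ofDet (M.dpPolicy arg w)) e
  have hxm := hm (M.ofDet (M.dpPolicy arg g)) e
  have hxm' := hm (M.ofDet (M.dpPolicy arg w)) e
  set x := M.marginal (M.ofDet (M.dpPolicy arg g)) e
  set x' := M.marginal (M.ofDet (M.dpPolicy arg w)) e
  calc _ = (x' - x) * (w e - g e) := by ring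
    _ ≤ |x' - x| * |w e - g e| := (le_abs_self _).trans_eq (abs_mul _ _)
    _ ≤ m e * |w e - g e| := mul_le_mul_of_nonneg_right
        (abs_sub_le_of_nonneg_of_le hx' hxm' hx hxm) (abs_nonneg _)

/-- Each sampled gain and its mean lie in `[0, f {e} - f ∅]`, so the error scales with the gain of
`e` itself, to be balanced by the weight `m e`. -/
theorem mean_abs_estimate_sub_gradient_le (M : SubmodularMDP S A) {y : S × A → ℝ}
    (h0 : ∀ e, 0 ≤ y e) (h1 : ∀ e, y e ≤ 1) (e : S × A) :
    (indepPMF fun _ : (S × A) × Fin (numSamples S A) => randomSubset y).mean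
      (fun X => |(∑ r, (M.f (insert e (X (e, r))) - M.f ((X (e, r)).erase e)))
        / (numSamples S A : ℝ) - M.gradient y e|)
      ≤ stepSize S A * (M.f {e} - M.f ∅) := by
  have : Nonempty S := ⟨M.s₁⟩
  have hg := M.gradient_mem_Icc h0 h1 e
  have hr : 0 ≤ M.f {e} - M.f ∅ := hg.1.trans hg.2
  refine (mean_abs_average_sub_le (fun _ : (S × A) × Fin (numSamples S A) => randomSubset y)
    (numSamples_pos S A) (fun r => (e, r)) (fun a b h => (Prod.ext_iff.1 h).2)
    (marginalGain M.f e) (M.gradient y e) (M.f {e} - M.f ∅) hr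
    (fun _ => mean_randomSubset h0 h1 _)
    (fun X => abs_sub_le_of_nonneg_of_le (marginalGain_nonneg M.f_mono e X)
      (marginalGain_le M.f_submodular e X) hg.1 hg.2)).trans ?_
  rw [div_eq_mul_one_div, mul_comm]
  exact mul_le_mul_of_nonneg_right (one_div_sqrt_numSamples_le S A) hr

/-- Given the earlier policies, the position is fixed and the samples are fresh, so the conditional
mean loss of each iteration has the same bound. -/
theorem mean_regret_le (M : SubmodularMDP S A) {arg : ℕ → S → (A → ℝ) → A}
    (harg : IsArgmaxRule arg) {m : S × A → ℝ} (hm : ∀ π e, M.marginal π e ≤ m e) (k : ℕ)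
    (hk : k ≤ numSteps S A) :
    (M.iterates arg k).mean (M.regret k)
      ≤ k * (stepSize S A * (stepSize S A * ∑ e, m e * (M.f {e} - M.f ∅))) := by
  have hm0 : ∀ e, 0 ≤ m e := fun e =>
    (M.marginal_nonneg (fun _ => PMF.pure (Classical.arbitrary A)) e).trans (hm _ e)
  induction k with
  | zero => simp [iterates, PMF.mean_pure, regret]
  | succ k ih =>
    have hk' := Nat.le_of_succ_le hk
    rw [iterates, PMF.mean_bind, Nat.cast_succ, add_mul, one_mul]
    refine le_trans (PMF.mean_mono (h := fun d => M.regret k d + stepSize S A *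
      (stepSize S A * ∑ e, m e * (M.f {e} - M.f ∅))) fun d => ?_) ?_
    · rw [gradientEstimate, PMF.map_comp, PMF.mean_map]
      refine (PMF.mean_mono (h := fun X => M.regret k d + stepSize S A * ∑ e, m e *
        |(∑ r, (M.f (insert e (X (e, r))) - M.f ((X (e, r)).erase e)))
          / (numSamples S A : ℝ) - M.gradient (M.position d) e|) fun X => ?_).trans ?_
      · simp only [Function.comp_apply, regret, Fin.snoc_castSucc, Fin.snoc_last]
        exact add_le_add le_rfl (mul_le_mul_of_nonneg_left
          (M.dpValue_sub_additiveValue_dpPolicy_le (harg k) hm _ _) (stepSize_nonneg S A))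
      · rw [PMF.mean_const_add, PMF.mean_mul_left, PMF.mean_sum]
        refine add_le_add le_rfl (mul_le_mul_of_nonneg_left ?_ (stepSize_nonneg S A))
        rw [Finset.mul_sum]
        refine Finset.sum_le_sum fun e _ => ?_
        rw [PMF.mean_mul_left, mul_left_comm]
        exact mul_le_mul_of_nonneg_left (M.mean_abs_estimate_sub_gradient_le
          (M.position_nonneg d) (M.position_le_one hk' d) e) (hm0 e)
    · rw [PMF.mean_add, PMF.mean_const]
      exact add_le_add (ih hk') le_rfl

/-! ### From the fractional point to the mixture of policies. -/

theorem multilinear_position_le_horizon_mul_randomValue (M : SubmodularMDP S A)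
    (d : Fin (numSteps S A) → S → A) :
    multilinear M.f (M.position d) ≤ M.H * M.randomValue (M.mixture d) := by
  have : Nonempty S := ⟨M.s₁⟩
  have hT := numSteps_mul_stepSize S A
  have : NeZero (numSteps S A) := ⟨fun h => by simp [h] at hT⟩
  have hval : M.randomValue (M.mixture d)
      = ∑ t, stepSize S A * M.value (M.ofDet (d t)) := by
    change ((M.mixture d).bind M.visited).mean M.f = _
    rw [mixture, PMF.bind_map, PMF.mean_bind, PMF.mean]
    refine Finset.sum_congr rfl fun t _ => ?_
    rw [PMF.uniformOfFintype_apply, Fintype.card_fin, ENNReal.toReal_inv, ENNReal.toReal_natCast,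
      ← eq_inv_of_mul_eq_one_right hT]
    rfl
  refine (multilinear_le_add_sum M.f_mono M.f_submodular (M.position_nonneg d)
    (M.position_le_one le_rfl d)).trans ?_
  -- As `T * δ = 1`, the term `f ∅` splits evenly over the policies.
  calc M.f ∅ + ∑ e, M.position d e * (M.f {e} - M.f ∅)
      = ∑ t, stepSize S A *
          (M.f ∅ + M.additiveValue (M.ofDet (d t)) fun e => M.f {e} - M.f ∅) := by
        simp only [mul_add, Finset.sum_add_distrib, Finset.sum_const, Finset.card_univ,
          Fintype.card_fin, nsmul_eq_mul, ← mul_assoc, hT, one_mul, position, additiveValue,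
          Finset.sum_mul, Finset.mul_sum]
        rw [Finset.sum_comm]
    _ ≤ ∑ t, stepSize S A * (M.H * M.value (M.ofDet (d t))) :=
        Finset.sum_le_sum fun t _ => mul_le_mul_of_nonneg_left
          (M.add_additiveValue_le_horizon_mul_value _) (stepSize_nonneg S A)
    _ = M.H * M.randomValue (M.mixture d) := by
        rw [hval, Finset.mul_sum]
        exact Finset.sum_congr rfl fun t _ => by ring

/-- A common bound `m` on the visiting probabilities of all policies for which `m e` times the
largest gain of `e` is at most the optimal value. -/
theorem exists_marginal_bound (M : SubmodularMDP S A) {opt : ℝ} (hopt : ∀ π, M.value π ≤ opt) :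
    ∃ m : S × A → ℝ, (∀ π e, M.marginal π e ≤ m e) ∧ ∀ e, m e * (M.f {e} - M.f ∅) ≤ opt := by
  have h0 : 0 ≤ opt :=
    (M.value_nonneg fun _ => PMF.pure (Classical.arbitrary A)).trans (hopt _)
  -- `m e` need not be a probability; it may exceed 1, and only its product with the gain matters.
  refine ⟨fun e => if M.f {e} - M.f ∅ = 0 then 1 else opt / (M.f {e} - M.f ∅),
    fun π e => ?_, fun e => ?_⟩ <;> dsimp only <;> split_ifs with h
  · exact M.marginal_le_one π e
  · have hr : 0 < M.f {e} - M.f ∅ :=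
      lt_of_le_of_ne (sub_nonneg.2 (M.f_mono _ _ (Finset.empty_subset _))) (Ne.symm h)
    exact (le_div_iff₀ hr).2 ((M.marginal_mul_le_value π e).trans (hopt π))
  · simpa [h] using h0
  · rw [div_mul_cancel₀ _ h]

/-- With probability at least `0.99` the regret is so small that continuous greedy attains the
fraction `1 - 1/e - 12/n` of the optimum, up to the factor `H`. -/
theorem continuousGreedy_guarantee (M : SubmodularMDP S A) {arg : ℕ → S → (A → ℝ) → A}
    (harg : IsArgmaxRule arg) :
    (99 / 100 : ENNReal) ≤ (M.continuousGreedy arg).toOuterMeasure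
      {ρ | ∀ π, (1 - 1 / Real.exp 1 - 12 / ((Fintype.card S * Fintype.card A : ℕ) : ℝ))
        * M.value π ≤ M.H * M.randomValue ρ} := by
  have : Nonempty S := ⟨M.s₁⟩
  set n : ℝ := ((Fintype.card S * Fintype.card A : ℕ) : ℝ) with hn
  have hn1 : 1 ≤ n := Nat.one_le_cast.2 (Nat.mul_pos Fintype.card_pos Fintype.card_pos)
  have hn0 : 0 < n := one_pos.trans_le hn1
  have hδ : stepSize S A * n = 1 / (9 * n) := by
    rw [stepSize, hn]
    push_cast
    have hS : (0 : ℝ) < Fintype.card S := Nat.cast_pos.2 Fintype.card_pos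
    have hA : (0 : ℝ) < Fintype.card A := Nat.cast_pos.2 Fintype.card_pos
    field_simp
  have hbdd : BddAbove (Set.range M.value) := ⟨_, Set.forall_mem_range.2 M.value_le_univ⟩
  have : Nonempty (Policy S A) := ⟨fun _ => PMF.pure (Classical.arbitrary A)⟩
  set opt := ⨆ π, M.value π with hopt
  have hle : ∀ π, M.value π ≤ opt := le_ciSup hbdd
  have hopt0 : 0 ≤ opt := (M.value_nonneg _).trans (hle (Classical.arbitrary _))
  obtain ⟨m, hm, hmr⟩ := M.exists_marginal_bound hle
  have hsum : ∑ e, m e * (M.f {e} - M.f ∅) ≤ n * opt := by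
    refine (Finset.sum_le_card_nsmul _ _ _ fun e _ => hmr e).trans_eq ?_
    rw [Finset.card_univ, Fintype.card_prod, nsmul_eq_mul]
  have hm0 : ∀ e, 0 ≤ m e := fun e =>
    (M.marginal_nonneg (Classical.arbitrary _) e).trans (hm _ e)
  have hmean : (M.iterates arg (numSteps S A)).mean (M.regret _) ≤ opt / (9 * n) := by
    refine (M.mean_regret_le harg hm _ le_rfl).trans ?_
    rw [← mul_assoc, numSteps_mul_stepSize, one_mul]
    refine (mul_le_mul_of_nonneg_left hsum (stepSize_nonneg S A)).trans_eq ?_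
    rw [← mul_assoc, hδ]
    ring
  rw [continuousGreedy, PMF.toOuterMeasure_map_apply]
  -- Markov's inequality needs a positive threshold; if `opt = 0` the claim is trivial.
  rcases hopt0.eq_or_lt with h0 | hpos
  · have huniv : M.mixture ⁻¹' {ρ | ∀ π, (1 - 1 / Real.exp 1 - 12 / n) * M.value π
        ≤ M.H * M.randomValue ρ} = Set.univ := by
      refine Set.eq_univ_of_forall fun d π => ?_
      rw [le_antisymm ((hle π).trans h0.ge) (M.value_nonneg π), mul_zero]
      exact mul_nonneg (Nat.cast_nonneg _) (M.randomValue_nonneg _)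
    rw [huniv, (PMF.toOuterMeasure_apply_eq_one_iff _ _).2 (Set.subset_univ _)]
    exact ENNReal.div_le_of_le_mul (by norm_num)
  -- The regret exceeds 100 times its mean bound with probability at most 1/100.
  have hmarkov := PMF.one_sub_le_toOuterMeasure_of_mean_le (M.regret_nonneg (numSteps S A))
    (c := 100 * (opt / (9 * n))) (b := 1 / 100) (by positivity)
    (hmean.trans_eq (by ring))
  have hnum : (99 / 100 : ENNReal) = ENNReal.ofReal (1 - 1 / 100) := by
    rw [show (1 - 1 / 100 : ℝ) = 99 / 100 by norm_num,
      ENNReal.ofReal_div_of_pos (by norm_num)]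
    norm_num
  rw [hnum]
  refine hmarkov.trans (MeasureTheory.measure_mono fun d hd π => ?_)
  have hprog := M.sub_multilinear_position_le (fun c hc => ciSup_le hc) hm _ le_rfl d
  have hgrad : stepSize S A * ∑ e, m e * (M.gradient (fun _ => 0) e - M.gradient (M.position d) e)
      ≤ opt / (9 * n) := by
    refine (mul_le_mul_of_nonneg_left ((Finset.sum_le_sum fun e _ =>
      mul_le_mul_of_nonneg_left ?_ (hm0 e)).trans hsum) (stepSize_nonneg S A)).trans_eq ?_
    · have h1 := (M.gradient_mem_Icc (y := fun _ => 0) (fun _ => le_rfl) (fun _ => zero_le_one) e).2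
      have h2 := (M.gradient_mem_Icc (M.position_nonneg d) (M.position_le_one le_rfl d) e).1
      linarith
    · rw [← mul_assoc, hδ]
      ring
  have hexp : (1 - stepSize S A) ^ numSteps S A ≤ 1 / Real.exp 1 := by
    have h1 : 1 - stepSize S A ≤ Real.exp (-stepSize S A) := by
      have := Real.add_one_le_exp (-stepSize S A)
      linarith
    refine (pow_le_pow_left₀ (sub_nonneg.2 (stepSize_le_one S A)) h1 _).trans_eq ?_
    rw [← Real.exp_nat_mul, mul_neg, numSteps_mul_stepSize, Real.exp_neg, one_div]
  have hfinal := M.multilinear_position_le_horizon_mul_randomValue d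
  have hd : M.regret (numSteps S A) d ≤ 100 * (opt / (9 * n)) := hd
  have hdecay := mul_le_mul_of_nonneg_right hexp hopt0
  have hF : (1 - 1 / Real.exp 1 - 12 / n) * opt ≤ multilinear M.f (M.position d) := by
    -- Regret and discretization cost 100 + 1 units of `opt / (9n)`; 108 rounds this up.
    have h12 : 12 / n * opt = 108 * (opt / (9 * n)) := by
      field_simp
      norm_num
    have : 0 ≤ opt / (9 * n) := by positivity
    linarith
  rcases le_total 0 (1 - 1 / Real.exp 1 - 12 / n) with hc | hc
  · exact (mul_le_mul_of_nonneg_left (hle π) hc).trans (hF.trans hfinal)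
  · exact (mul_nonpos_of_nonpos_of_nonneg hc (M.value_nonneg π)).trans
      (mul_nonneg (Nat.cast_nonneg _) (M.randomValue_nonneg _))

end SubmodularMDP

theorem mainTheorem1 :
    ∃ ε : ℕ → ℝ,
      Filter.Tendsto ε Filter.atTop (nhds 0) ∧
      (∀ n, 0 ≤ ε n ∧ ε n ≤ 1 - 1 / Real.exp 1) ∧
      ∀ (S : Type*) (A : Type*) [Fintype S] [Fintype A] [DecidableEq S] [DecidableEq A]
        [Nonempty A] (M : SubmodularMDP S A) (arg : ℕ → S → (A → ℝ) → A),
        IsArgmaxRule arg →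
        (99 / 100 : ENNReal) ≤
          (M.continuousGreedy arg).toOuterMeasure
            {ρ | ∀ πstar : Policy S A,
              (1 - 1 / Real.exp 1 - ε (Fintype.card S * Fintype.card A)) ^ 2 / (M.H : ℝ)
                * M.value πstar ≤ M.randomValue ρ} := by
  have he : 0 ≤ 1 - 1 / Real.exp 1 :=
    sub_nonneg.2 ((div_le_one (Real.exp_pos 1)).2 (Real.one_le_exp zero_le_one))
  -- Where the minimum caps the error, the guarantee degenerates to `0 ≤ randomValue`.
  refine ⟨fun n => min (1 - 1 / Real.exp 1) (12 / (n : ℝ)), ?_,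
    fun n => ⟨le_min he (by positivity), min_le_left _ _⟩, ?_⟩
  · refine squeeze_zero (fun n => le_min he (by positivity)) (fun n => min_le_right _ _)
      (tendsto_const_div_atTop_nhds_zero_nat 12)
  · intro S A _ _ _ _ _ M arg harg
    refine (M.continuousGreedy_guarantee harg).trans
      (MeasureTheory.measure_mono fun ρ hρ π => ?_)
    have hH : (0 : ℝ) < M.H := Nat.cast_pos.2 M.H_pos
    have hρ := hρ π
    have hv := M.value_nonneg π
    rw [div_mul_eq_mul_div, div_le_iff₀ hH, mul_comm (M.randomValue ρ)]
    dsimp only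
    rcases min_cases (1 - 1 / Real.exp 1) (12 / ((Fintype.card S * Fintype.card A : ℕ) : ℝ)) with
      ⟨h, -⟩ | ⟨h, hlt⟩
    · rw [h, sub_self, zero_pow two_ne_zero, zero_mul]
      exact mul_nonneg hH.le (M.randomValue_nonneg ρ)
    · rw [h]
      refine le_trans (mul_le_mul_of_nonneg_right ?_ hv) hρ
      have h1 : 0 ≤ 12 / ((Fintype.card S * Fintype.card A : ℕ) : ℝ) := by positivity
      have h2 : 0 < 1 / Real.exp 1 := by positivity
      -- The factor lies in `[0, 1]`, so its square is at most the factor already obtained.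
      exact pow_le_of_le_one (sub_nonneg.2 hlt.le) (by linarith) two_ne_zero
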